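/- Let $d,n\ge 1$ be integers and let $\omega:[0,d]\to[0,\infty)$ be a modulus of regularity, i.e. $\omega(0)=0$ and $\omega$ is nondecreasing and concave (continuity at $0$ is not required). A function $g$ is called $\omega$-regular on $[0,1]^d$ if $|g(x)-g(x')|\le\omega(\|x-x'\|_1)$ for all $x,x'\in[0,1]^d$; one then says that $\omega$ is a modulus of regularity of $g$ on $[0,1]^d$. A ReLU MLP with input dimension $d$ and output dimension $1$ is a network consisting of finitely many hidden layers $z\mapsto\sigma(Wz+b)$, with $\sigma(t)=\max\{0,t\}$ applied componentwise, followed by an affine output map; its depth is the number of hidden layers, its width is the largest number of neurons in a hidden layer, its parameters are all entries of its weight matrices and bias vectors, and $|\Phi|_{\rm par}$ is the largest absolute value of a parameter. For a function $f$ on $[0,1]^d$ let $\mathcal E_n(f)=(f(y/n))_{y\in\{0,\dots,n\}^d}\in\mathbb R^{(n+1)^d}$ be the vector of its values on the grid $\frac1n\mathbb Z^d\cap[0,1]^d$. Then there is a map (decoder) $\mathcal D_n$ from $\mathbb R^{(n+1)^d}$ to the ReLU MLPs with input dimension $d$ and output dimension $1$ such that, for every $\omega$-regular $f:[0,1]^d\to\mathbb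 R$, the network $\Phi=\mathcal D_n(\mathcal E_n(f))$ has the following properties. 1. $\Phi$ has width at most $8d(n+1)^d$, depth at most $\lceil\log_2 d\rceil+4$, at most $16d(n+1)^d$ nonzero parameters, and $|\Phi|_{\rm par}\le\max\{n,\max_{y\in\{0,\dots,n\}^d}|f(y/n)|\}$. 2. $|f(x)-\Phi(x)|\le\omega\left(\frac{d}{2n}\right)$ for every $x\in[0,1]^d$. 3. $\Phi$ is $\omega$-regular on $[0,1]^d$. 4. $\Phi(y/n)=f(y/n)$ for every $y\in\{0,\dots,n\}^d$. 5. $\Phi$ is continuous on $[0,1]^d$ and affine on each simplex of the following triangulation: each cell $\prod_i[\frac{m_i}{n},\frac{m_i+1}{n}]$, $m\in\{0,\dots,n-1\}^d$, is triangulated by the images of the Kuhn simplices $\operatorname{conv}\{\sum_{i\le k}e_{\tau(i)}:0\le k\le d\}$, $\tau\in S_d$, under the affine bijection from $[0,1]^d$ onto the cell with coordinates $z_i\mapsto\frac{m_i+z_i}{n}$ if $m_i$ is even and $z_i\mapsto\frac{m_i+1-z_i}{n}$ if $m_i$ is odd. 6. For every $x\in\mathbb R^d$, $\Phi(x)=\sum_{y\in\{0,\dots,n\}^d}f(y/n)\,T_y(nx)$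 with the hat functions $$T_y(x)=\sigma\bigl(1-\max\{|x_i-y_i|:y_i\text{ even}\}-\max\{|x_i-y_i|:y_i\text{ odd}\}\bigr),$$ where the maximum of the empty set is $0$. Moreover $\{x\in\mathbb R^d:\Phi(x)\neq0\}\subseteq[-\frac1n,1+\frac1n]^d$. -/

import Mathlib

/-- The unit cube `[0,1]^d`. -/
def unitCube (d : ℕ) : Set (Fin d → ℝ) :=
  {x | ∀ i, 0 ≤ x i ∧ x i ≤ 1}

/-- The distance induced by the `ℓ¹` norm on `ℝ^d`. -/
noncomputable def l1Dist {d : ℕ} (x y : Fin d → ℝ) : ℝ :=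
  ∑ i, |x i - y i|

/-- A modulus of regularity `ω : I → [0,∞)`; only the values of `ω` on `I` matter.
It need not be continuous at `0`. -/
structure IsModulusOfRegularity (I : Set ℝ) (ω : ℝ → ℝ) : Prop where
  nonneg : ∀ t ∈ I, 0 ≤ ω t
  map_zero : ω 0 = 0
  monotoneOn : MonotoneOn ω I
  concaveOn : ConcaveOn ℝ I ω

/-- `g` is `ω`-regular on `X ⊆ (ℝ^d, ℓ¹)`. -/
def IsRegularOn {d : ℕ} (ω : ℝ → ℝ) (X : Set (Fin d → ℝ)) (g : (Fin d → ℝ) → ℝ) : Prop :=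
  ∀ x ∈ X, ∀ y ∈ X, |g x - g y| ≤ ω (l1Dist x y)

/-- The rectified linear unit. -/
noncomputable def relu (t : ℝ) : ℝ := max 0 t

/-- (Parametrised) ReLU multilayer perceptrons with input dimension `d` and output dimension `D`:
a finite list of hidden layers `x ↦ relu (W x + b)`, each with a positive number of neurons,
followed by an affine output map. -/
inductive ReLUMLP : ℕ → ℕ → Type
  | output {d D : ℕ} (W : Matrix (Fin D) (Fin d) ℝ) (b : Fin D → ℝ) : ReLUMLP d D
  | hidden {d k D : ℕ} (hk : 0 < k) (W : Matrix (Fin k) (Fin d) ℝ) (b : Fin k → ℝ)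
      (rest : ReLUMLP k D) : ReLUMLP d D

namespace ReLUMLP

/-- The function implemented by the network. -/
noncomputable def eval : {d D : ℕ} → ReLUMLP d D → (Fin d → ℝ) → (Fin D → ℝ)
  | _, _, output W b, x => W.mulVec x + b
  | _, _, hidden _ W b rest, x => rest.eval (fun i => relu ((W.mulVec x + b) i))

/-- The depth: the number of hidden layers. -/
def depth : {d D : ℕ} → ReLUMLP d D → ℕ
  | _, _, output _ _ => 0
  | _, _, hidden _ _ _ rest => rest.depth + 1

/-- The width: the largest number of neurons of a hidden layer. -/
def width : {d D : ℕ} → ReLUMLP d D → ℕ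
  | _, _, output _ _ => 0
  | _, _, hidden (k := k) _ _ _ rest => max k rest.width

/-- The number of nonzero entries of a weight matrix and a bias vector. -/
noncomputable def layerNonzero {k d : ℕ} (W : Matrix (Fin k) (Fin d) ℝ) (b : Fin k → ℝ) : ℕ :=
  (Finset.univ.filter fun p : Fin k × Fin d => W p.1 p.2 ≠ 0).card +
    (Finset.univ.filter fun i : Fin k => b i ≠ 0).card

/-- The number of nonzero parameters (weights and biases) of the network. -/
noncomputable def numNonzero : {d D : ℕ} → ReLUMLP d D → ℕ
  | _, _, output W b => layerNonzero W b
  | _, _, hidden _ W b rest => layerNonzero W b + rest.numNonzero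

/-- The largest absolute value of an entry of a weight matrix or a bias vector (the norm of a
finite family of real numbers is the maximum norm). -/
noncomputable def layerNorm {k d : ℕ} (W : Matrix (Fin k) (Fin d) ℝ) (b : Fin k → ℝ) : ℝ :=
  max ‖fun p : Fin k × Fin d => W p.1 p.2‖ ‖b‖

/-- The parameter norm: the largest absolute value of a weight or a bias of the network. -/
noncomputable def parNorm : {d D : ℕ} → ReLUMLP d D → ℝ
  | _, _, output W b => layerNorm W b
  | _, _, hidden _ W b rest => max (layerNorm W b) rest.parNorm

/-- The real-valued function implemented by a network with one output. -/
noncomputable def toFun {d : ℕ} (Φ : ReLUMLP d 1) (x : Fin d → ℝ) : ℝ := Φ.eval x 0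

end ReLUMLP

/-- The grid points `y / n`, `y ∈ {0, …, n}^d`, that is, the points of `(1/n)ℤ^d ∩ [0,1]^d`. -/
noncomputable def gridPoint {d : ℕ} (n : ℕ) (y : Fin d → Fin (n + 1)) : Fin d → ℝ :=
  fun i => ((y i : ℕ) : ℝ) / n

/-- The encoder: the `(n+1)^d` sample values of `f` on the grid. -/
noncomputable def encoder {d : ℕ} (n : ℕ) (f : (Fin d → ℝ) → ℝ) :
    (Fin d → Fin (n + 1)) → ℝ :=
  fun y => f (gridPoint n y)

/-- The hat function centred at the lattice point `y`; the maximum of an empty family is `0`. -/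
noncomputable def hat {d : ℕ} (y : Fin d → ℕ) (x : Fin d → ℝ) : ℝ :=
  relu (1
    - (Finset.univ.filter fun i => Even (y i)).fold max 0 (fun i => |x i - y i|)
    - (Finset.univ.filter fun i => Odd (y i)).fold max 0 (fun i => |x i - y i|))

/-- The vertex `∑_{i < k} e_{τ(i)}` of the Kuhn simplex of the permutation `τ`. -/
noncomputable def kuhnVertex {d : ℕ} (τ : Equiv.Perm (Fin d)) (k : Fin (d + 1)) : Fin d → ℝ :=
  ∑ i ∈ Finset.univ.filter (fun i : Fin d => (i : ℕ) < (k : ℕ)), Pi.single (τ i) (1 : ℝ)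

/-- The simplex of the Kuhn triangulation of `[0,1]^d` that belongs to the permutation `τ`. -/
noncomputable def kuhnSimplex {d : ℕ} (τ : Equiv.Perm (Fin d)) : Set (Fin d → ℝ) :=
  convexHull ℝ (Set.range (kuhnVertex τ))

/-- The affine bijection of `[0,1]^d` onto the grid cell `∏ i, [m i / n, (m i + 1) / n]` which
reflects exactly the coordinates `i` with `m i` odd. -/
noncomputable def cellMap {d : ℕ} (n : ℕ) (m : Fin d → ℕ) (z : Fin d → ℝ) : Fin d → ℝ :=
  fun i => if Even (m i) then (m i + z i) / n else (m i + 1 - z i) / n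

/-- `g` is continuous on `[0,1]^d` and affine on every simplex of the triangulation of `[0,1]^d`
that consists of the (reflected) Kuhn triangulations of the `n^d` grid cells of side `1/n`. -/
def IsKuhnPiecewiseLinear {d : ℕ} (n : ℕ) (g : (Fin d → ℝ) → ℝ) : Prop :=
  ContinuousOn g (unitCube d) ∧
    ∀ (m : Fin d → Fin n) (τ : Equiv.Perm (Fin d)), ∃ A : (Fin d → ℝ) →ᵃ[ℝ] ℝ,
      Set.EqOn g A (cellMap n (fun i => (m i : ℕ)) '' kuhnSimplex τ)

/-! The interpolant is an expectation. Draw one threshold `t` uniformly from `[0, 1)` and round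
every coordinate of `u = n x` with that same `t`: to its even neighbour if that lies within `t`,
otherwise to the odd one. The values of `t` that send `u` to `y` form the interval `[E, 1 - O)`,
with `E` and `O` the maximal distances over the even and odd coordinates of `y`; its length is the
hat function (`hat_eq_measureReal`). Hence the hat combination at `x` is the mean of `f` at the
rounded grid point.

Rounding is unbiased and, for fixed `t`, monotone, so the expected distance between the rounded
images of two points equals the distance of the points. Jensen's inequality for the concave `ω` then
preserves regularity (`isRegularOn_hatInterpolant`). The expected displacement of a coordinate is at
most `1/2`, which gives the error bound (`abs_sub_hatInterpolant_le`).

On a reflected Kuhn simplex the order of the coordinates is fixed, so both maxima are attained at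
fixed coordinates (`isAffineOn_hat`). The network computes the maxima by binary trees of `max s t =
relu (s - t) + relu t`, `t ≥ 0` (`isRealizable_sum_relu_slotMax`). -/

/-! ### Expectations over finite types. -/

open MeasureTheory in
/-- Integration of a function of a random element of a finite type. -/
theorem integral_comp_finite {Ω ι : Type*} [MeasurableSpace Ω] [Fintype ι] [MeasurableSpace ι]
    [MeasurableSingletonClass ι] (μ : Measure Ω) [IsFiniteMeasure μ] {P : Ω → ι}
    (hP : Measurable P) (h : ι → ℝ) :
    ∫ t, h (P t) ∂μ = ∑ i, μ.real (P ⁻¹' {i}) * h i := by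
  have hm : Measurable h := measurable_of_finite h
  rw [← integral_map (μ := μ) hP.aemeasurable hm.aestronglyMeasurable,
    integral_fintype (Integrable.of_finite)]
  refine Finset.sum_congr rfl fun i _ => ?_
  rw [map_measureReal_apply hP (measurableSet_singleton i), smul_eq_mul]

open MeasureTheory in
theorem integrable_comp_finite {Ω ι : Type*} [MeasurableSpace Ω] [Fintype ι] [MeasurableSpace ι]
    [MeasurableSingletonClass ι] (μ : Measure Ω) [IsFiniteMeasure μ] {P : Ω → ι}
    (hP : Measurable P) (h : ι → ℝ) : Integrable (fun t => h (P t)) μ :=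
  (Integrable.of_finite (μ := μ.map P) (f := h)).comp_measurable hP

open MeasureTheory in
/-- Jensen's inequality for a random element of a finite type. -/
theorem ConcaveOn.integral_comp_finite_le {Ω ι : Type*} [MeasurableSpace Ω] [Fintype ι]
    [MeasurableSpace ι] [MeasurableSingletonClass ι] (μ : Measure Ω) [IsProbabilityMeasure μ]
    {P : Ω → ι} (hP : Measurable P) {s : Set ℝ} {ω : ℝ → ℝ} (hω : ConcaveOn ℝ s ω)
    (φ : ι → ℝ) (hφ : ∀ i, φ i ∈ s) :
    ∫ t, ω (φ (P t)) ∂μ ≤ ω (∫ t, φ (P t) ∂μ) := by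
  rw [integral_comp_finite μ hP (fun i => ω (φ i)), integral_comp_finite μ hP φ]
  refine hω.le_map_sum (fun i _ => measureReal_nonneg) ?_ (fun i _ => hφ i)
  simpa using (integral_comp_finite μ hP (fun _ => (1 : ℝ))).symm

/-! ### Rounding a real number with a random threshold. -/

/-- Rounding of `s` to a neighbouring integer: to the even one if its distance is at most `t`, and
to the odd one otherwise. -/
noncomputable def thresholdRound (t s : ℝ) : ℤ := ⌊(s + t) / 2⌋ + ⌈(s - t) / 2⌉

/-- Monotonicity is immediate from the floor-plus-ceiling form; it is what later couples the
roundings of two points. -/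
theorem thresholdRound_mono (t : ℝ) : Monotone (thresholdRound t) := fun a b hab =>
  add_le_add (Int.floor_le_floor (by linarith)) (Int.ceil_le_ceil (by linarith))

theorem measurable_thresholdRound (s : ℝ) : Measurable fun t => thresholdRound t s := by
  unfold thresholdRound
  exact (Int.measurable_floor.comp (by fun_prop)).add (Int.measurable_ceil.comp (by fun_prop))

theorem thresholdRound_eq_even {t s : ℝ} (ht : t ∈ Set.Ico (0 : ℝ) 1) {k : ℤ}
    (h : |s - ((2 * k : ℤ) : ℝ)| ≤ t) : thresholdRound t s = 2 * k := by
  obtain ⟨h1, h2⟩ := abs_le.1 h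
  obtain ⟨h3, h4⟩ := ht
  push_cast at h1 h2
  have hf : ⌊(s + t) / 2⌋ = k := Int.floor_eq_iff.2 ⟨by linarith, by linarith⟩
  have hc : ⌈(s - t) / 2⌉ = k := Int.ceil_eq_iff.2 ⟨by linarith, by linarith⟩
  rw [thresholdRound, hf, hc]
  ring

theorem thresholdRound_eq_odd {t s : ℝ} (ht : t ∈ Set.Ico (0 : ℝ) 1) {k : ℤ}
    (h : |s - ((2 * k + 1 : ℤ) : ℝ)| < 1 - t) : thresholdRound t s = 2 * k + 1 := by
  obtain ⟨h1, h2⟩ := abs_lt.1 h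
  obtain ⟨h3, h4⟩ := ht
  push_cast at h1 h2
  have hf : ⌊(s + t) / 2⌋ = k := Int.floor_eq_iff.2 ⟨by linarith, by linarith⟩
  have hc : ⌈(s - t) / 2⌉ = k + 1 :=
    Int.ceil_eq_iff.2 ⟨by push_cast; linarith, by push_cast; linarith⟩
  rw [thresholdRound, hf, hc]
  ring

/-- Closed intervals of radius `t` about the even integers and open ones of radius `1 - t` about the
odd integers cover the line, which turns the two sufficient conditions above into equivalences. -/
theorem thresholdRound_dichotomy (t s : ℝ) :
    (∃ k : ℤ, |s - ((2 * k : ℤ) : ℝ)| ≤ t) ∨ ∃ k : ℤ, |s - ((2 * k + 1 : ℤ) : ℝ)| < 1 - t := by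
  have h1 := Int.floor_le ((s + t) / 2)
  have h2 := Int.lt_floor_add_one ((s + t) / 2)
  rcases le_or_gt (s - 2 * ⌊(s + t) / 2⌋) t with h | h
  · refine Or.inl ⟨⌊(s + t) / 2⌋, abs_le.2 ?_⟩
    push_cast
    constructor <;> linarith
  · refine Or.inr ⟨⌊(s + t) / 2⌋, abs_lt.2 ?_⟩
    push_cast
    constructor <;> linarith

theorem thresholdRound_eq_iff_even {t : ℝ} (ht : t ∈ Set.Ico (0 : ℝ) 1) (s : ℝ) {m : ℤ}
    (hm : Even m) : thresholdRound t s = m ↔ |s - m| ≤ t := by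
  obtain ⟨j, hj⟩ := hm
  obtain rfl : m = 2 * j := by omega
  refine ⟨fun h => ?_, thresholdRound_eq_even ht⟩
  rcases thresholdRound_dichotomy t s with ⟨k, hk⟩ | ⟨k, hk⟩
  · rwa [← h, thresholdRound_eq_even ht hk]
  · have := thresholdRound_eq_odd ht hk
    omega

theorem thresholdRound_eq_iff_odd {t : ℝ} (ht : t ∈ Set.Ico (0 : ℝ) 1) (s : ℝ) {m : ℤ}
    (hm : Odd m) : thresholdRound t s = m ↔ |s - m| < 1 - t := by
  obtain ⟨j, rfl⟩ := hm
  refine ⟨fun h => ?_, thresholdRound_eq_odd ht⟩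
  rcases thresholdRound_dichotomy t s with ⟨k, hk⟩ | ⟨k, hk⟩
  · have := thresholdRound_eq_even ht hk
    omega
  · rwa [← h, thresholdRound_eq_odd ht hk]

theorem thresholdRound_intCast {t : ℝ} (ht : t ∈ Set.Ico (0 : ℝ) 1) (m : ℤ) :
    thresholdRound t m = m := by
  rcases Int.even_or_odd m with hm | hm
  · rw [thresholdRound_eq_iff_even ht _ hm]
    simpa using ht.1
  · rw [thresholdRound_eq_iff_odd ht _ hm]
    simpa using ht.2

theorem thresholdRound_nonneg {t s : ℝ} (ht : t ∈ Set.Ico (0 : ℝ) 1) (hs : 0 ≤ s) :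
    0 ≤ thresholdRound t s := by
  have h := thresholdRound_mono t hs
  have h' := thresholdRound_intCast ht 0
  rw [Int.cast_zero] at h'
  omega

theorem thresholdRound_le {t s : ℝ} (ht : t ∈ Set.Ico (0 : ℝ) 1) {n : ℕ} (hs : s ≤ n) :
    thresholdRound t s ≤ n := by
  have h := thresholdRound_mono t hs
  have h' := thresholdRound_intCast ht n
  rw [Int.cast_natCast] at h'
  omega

open MeasureTheory in
/-- The uniform distribution on `[0, 1)`. -/
noncomputable def thresholdMeasure : Measure ℝ := volume.restrict (Set.Ico 0 1)

open MeasureTheory in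
instance : IsProbabilityMeasure thresholdMeasure :=
  ⟨by simp [thresholdMeasure]⟩

open MeasureTheory in
theorem ae_thresholdMeasure : ∀ᵐ t ∂thresholdMeasure, t ∈ Set.Ico (0 : ℝ) 1 :=
  ae_restrict_mem measurableSet_Ico

open MeasureTheory in
theorem integral_thresholdMeasure_ite {r : ℝ} (h0 : 0 ≤ r) (h1 : r ≤ 1) (a b : ℝ) :
    ∫ t, (if t < r then a else b) ∂thresholdMeasure = r * a + (1 - r) * b := by
  have e : (fun t : ℝ => if t < r then a else b)
      = fun t => (Set.Iio r).indicator (fun _ => a - b) t + b := by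
    funext t
    by_cases h : t < r <;> simp [h]
  rw [e, integral_add ((integrable_const _).indicator measurableSet_Iio) (integrable_const _),
    integral_indicator_const _ measurableSet_Iio]
  have hs : thresholdMeasure.real (Set.Iio r) = r := by
    rw [thresholdMeasure, measureReal_restrict_apply measurableSet_Iio]
    have : Set.Iio r ∩ Set.Ico 0 1 = Set.Ico 0 r := by
      ext t
      simp only [Set.mem_inter_iff, Set.mem_Iio, Set.mem_Ico]
      constructor
      · rintro ⟨h, h', -⟩
        exact ⟨h', h⟩
      · rintro ⟨h, h'⟩
        exact ⟨h', h, by linarith⟩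
    rw [this, Real.volume_real_Ico_of_le h0, sub_zero]
  rw [hs]
  simp
  ring

/-- Parity does not affect the law. If `⌊s⌋` is even, the odd neighbour above is chosen iff `t <
fract s`; if it is odd, it is itself chosen iff `t < 1 - fract s`. -/
theorem integral_comp_thresholdRound (s : ℝ) (h : ℤ → ℝ) :
    ∫ t, h (thresholdRound t s) ∂thresholdMeasure
      = (1 - Int.fract s) * h ⌊s⌋ + Int.fract s * h (⌊s⌋ + 1) := by
  have hr0 := Int.fract_nonneg s
  have hr1 := Int.fract_lt_one s
  have hs := Int.floor_add_fract s
  set m := ⌊s⌋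
  set r := Int.fract s
  rcases Int.even_or_odd m with hm | hm
  · rw [← integral_thresholdMeasure_ite hr0 hr1.le (h (m + 1)) (h m) |>.trans (add_comm _ _)]
    refine MeasureTheory.integral_congr_ae ?_
    filter_upwards [ae_thresholdMeasure] with t ht
    split_ifs with htr
    · rw [(thresholdRound_eq_iff_odd ht s (m := m + 1) hm.add_one).2]
      rw [abs_lt]
      push_cast
      constructor <;> linarith
    · rw [(thresholdRound_eq_iff_even ht s hm).2]
      rw [abs_le]
      constructor <;> linarith [ht.1]
  · have e := integral_thresholdMeasure_ite (r := 1 - r) (by linarith) (by linarith) (h m)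
      (h (m + 1))
    rw [sub_sub_cancel] at e
    rw [← e]
    refine MeasureTheory.integral_congr_ae ?_
    filter_upwards [ae_thresholdMeasure] with t ht
    split_ifs with htr
    · rw [(thresholdRound_eq_iff_odd ht s hm).2]
      rw [abs_lt]
      constructor <;> linarith
    · rw [(thresholdRound_eq_iff_even ht s (m := m + 1) hm.add_one).2]
      rw [abs_le]
      push_cast
      constructor <;> linarith

theorem integral_thresholdRound (s : ℝ) :
    ∫ t, (thresholdRound t s : ℝ) ∂thresholdMeasure = s := by
  rw [integral_comp_thresholdRound s (fun k => (k : ℝ))]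
  have hs := Int.floor_add_fract s
  push_cast
  linear_combination hs

theorem integral_abs_sub_thresholdRound_le (s : ℝ) :
    ∫ t, |s - (thresholdRound t s : ℝ)| ∂thresholdMeasure ≤ 1 / 2 := by
  rw [integral_comp_thresholdRound s (fun k => |s - (k : ℝ)|)]
  have hr0 := Int.fract_nonneg s
  have hr1 := Int.fract_lt_one s
  have hs := Int.floor_add_fract s
  have e1 : s - ((⌊s⌋ : ℤ) : ℝ) = Int.fract s := by linarith
  have e2 : s - ((⌊s⌋ + 1 : ℤ) : ℝ) = -(1 - Int.fract s) := by push_cast; linarith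
  rw [e1, e2, abs_neg, abs_of_nonneg hr0, abs_of_nonneg (by linarith)]
  -- With `r = fract s` the integral is `2 r (1 - r) = 1/2 - 2 (r - 1/2)²`.
  nlinarith [sq_nonneg (Int.fract s - 1 / 2)]

/-! ### Random rounding to lattice points and its law. -/

/-- Coordinatewise rounding to the lattice points of `[0, n]^d`. -/
noncomputable def latticeRound {d : ℕ} (n : ℕ) (u : Fin d → ℝ) (t : ℝ) : Fin d → Fin (n + 1) :=
  -- The truncations only make the type fit: they are inactive for `t ∈ [0, 1)` and `u i ∈ [0, n]`.
  fun i => ⟨min (thresholdRound t (u i)).toNat n, by omega⟩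

theorem measurable_latticeRound {d : ℕ} (n : ℕ) (u : Fin d → ℝ) :
    Measurable (latticeRound n u) :=
  measurable_pi_lambda _ fun i =>
    (measurable_of_countable fun k : ℤ => (⟨min k.toNat n, by omega⟩ : Fin (n + 1))).comp
      (measurable_thresholdRound (u i))

theorem coe_latticeRound {d n : ℕ} {u : Fin d → ℝ} {t : ℝ} (ht : t ∈ Set.Ico (0 : ℝ) 1)
    {i : Fin d} (hu : 0 ≤ u i ∧ u i ≤ n) :
    ((latticeRound n u t i : ℕ) : ℤ) = thresholdRound t (u i) := by
  have h0 := thresholdRound_nonneg ht hu.1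
  have h1 := thresholdRound_le ht hu.2
  simp only [latticeRound]
  omega

theorem coe_real_latticeRound {d n : ℕ} {u : Fin d → ℝ} {t : ℝ} (ht : t ∈ Set.Ico (0 : ℝ) 1)
    {i : Fin d} (hu : 0 ≤ u i ∧ u i ≤ n) :
    ((latticeRound n u t i : ℕ) : ℝ) = (thresholdRound t (u i) : ℝ) := by
  exact_mod_cast congrArg (Int.cast : ℤ → ℝ) (coe_latticeRound ht hu)

theorem latticeRound_eq_iff {d n : ℕ} {u : Fin d → ℝ} {t : ℝ} (ht : t ∈ Set.Ico (0 : ℝ) 1)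
    (hu : ∀ i, 0 ≤ u i ∧ u i ≤ n) (y : Fin d → Fin (n + 1)) :
    latticeRound n u t = y ↔
      (∀ i, Even (y i : ℕ) → |u i - (y i : ℕ)| ≤ t) ∧
        ∀ i, Odd (y i : ℕ) → |u i - (y i : ℕ)| < 1 - t := by
  have key : ∀ i, latticeRound n u t i = y i ↔ thresholdRound t (u i) = ((y i : ℕ) : ℤ) := by
    intro i
    rw [← coe_latticeRound ht (hu i), Fin.ext_iff]
    omega
  rw [funext_iff, ← forall_and]
  refine forall_congr' fun i => ?_
  rw [key]
  rcases Nat.even_or_odd (y i : ℕ) with h | h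
  · rw [thresholdRound_eq_iff_even ht _ (by exact_mod_cast h)]
    simp [h, Nat.not_odd_iff_even.2 h]
  · rw [thresholdRound_eq_iff_odd ht _ (by exact_mod_cast h)]
    simp [h, Nat.not_even_iff_odd.2 h]

/-- A hat function is the distribution of the rounded point. -/
theorem hat_eq_measureReal {d n : ℕ} {u : Fin d → ℝ} (hu : ∀ i, 0 ≤ u i ∧ u i ≤ n)
    (y : Fin d → Fin (n + 1)) :
    hat (fun i => (y i : ℕ)) u = thresholdMeasure.real (latticeRound n u ⁻¹' {y}) := by
  unfold hat
  set E := (Finset.univ.filter fun i => Even (y i : ℕ)).fold max 0 (fun i => |u i - (y i : ℕ)|)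
    with hE
  set O := (Finset.univ.filter fun i => Odd (y i : ℕ)).fold max 0 (fun i => |u i - (y i : ℕ)|)
    with hO
  have hE0 : 0 ≤ E := Finset.le_fold_max 0 |>.2 (Or.inl le_rfl)
  have hO0 : 0 ≤ O := Finset.le_fold_max 0 |>.2 (Or.inl le_rfl)
  -- Even coordinates of `y` bound `t` from below, odd ones from above, so the event is an interval.
  have hset : latticeRound n u ⁻¹' {y} ∩ Set.Ico 0 1 = Set.Ico E (1 - O) := by
    ext t
    have hEt : E ≤ t ↔ 0 ≤ t ∧ ∀ i, Even (y i : ℕ) → |u i - (y i : ℕ)| ≤ t := by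
      rw [hE, Finset.fold_max_le]
      simp
    have hOt : t < 1 - O ↔ t < 1 ∧ ∀ i, Odd (y i : ℕ) → |u i - (y i : ℕ)| < 1 - t := by
      rw [lt_sub_comm, hO, Finset.fold_max_lt]
      simp
    rw [Set.mem_Ico, hEt, hOt, Set.mem_inter_iff, Set.mem_preimage, Set.mem_singleton_iff]
    constructor
    · rintro ⟨h, ht⟩
      rw [latticeRound_eq_iff ht hu] at h
      exact ⟨⟨ht.1, h.1⟩, ht.2, h.2⟩
    · rintro ⟨⟨h1, h2⟩, h3, h4⟩
      exact ⟨(latticeRound_eq_iff ⟨h1, h3⟩ hu y).2 ⟨h2, h4⟩, h1, h3⟩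
  rw [thresholdMeasure, MeasureTheory.measureReal_restrict_apply
    (measurable_latticeRound n u (measurableSet_singleton y)), hset, Real.volume_real_Ico, relu,
    max_comm]
  congr 1
  ring

/-! ### The interpolant as an expectation: regularity, error, grid values, support. -/

/-- The combination of the hat functions with coefficients `v`, on the scale of the unit cube. -/
noncomputable def hatInterpolant {d : ℕ} (n : ℕ) (v : (Fin d → Fin (n + 1)) → ℝ)
    (x : Fin d → ℝ) : ℝ :=
  ∑ y : Fin d → Fin (n + 1), v y * hat (fun i => (y i : ℕ)) (fun i => (n : ℝ) * x i)

theorem scaled_mem_of_mem_unitCube {d : ℕ} (n : ℕ) {x : Fin d → ℝ} (hx : x ∈ unitCube d)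
    (i : Fin d) : 0 ≤ (n : ℝ) * x i ∧ (n : ℝ) * x i ≤ n := by
  have hn : (0 : ℝ) ≤ n := n.cast_nonneg
  exact ⟨mul_nonneg hn (hx i).1, mul_le_of_le_one_right hn (hx i).2⟩

theorem hatInterpolant_eq_integral {d n : ℕ} (v : (Fin d → Fin (n + 1)) → ℝ) {x : Fin d → ℝ}
    (hx : x ∈ unitCube d) :
    hatInterpolant n v x
      = ∫ t, v (latticeRound n (fun i => (n : ℝ) * x i) t) ∂thresholdMeasure := by
  rw [integral_comp_finite thresholdMeasure (measurable_latticeRound n _) v, hatInterpolant]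
  refine Finset.sum_congr rfl fun y _ => ?_
  rw [hat_eq_measureReal (scaled_mem_of_mem_unitCube n hx), mul_comm]

theorem gridPoint_mem_unitCube {d n : ℕ} (y : Fin d → Fin (n + 1)) :
    gridPoint n y ∈ unitCube d := by
  intro i
  refine ⟨by unfold gridPoint; positivity, div_le_one_of_le₀ ?_ n.cast_nonneg⟩
  exact_mod_cast Nat.lt_succ_iff.1 (y i).2

theorem l1Dist_mem_Icc {d : ℕ} {x y : Fin d → ℝ} (hx : x ∈ unitCube d) (hy : y ∈ unitCube d) :
    l1Dist x y ∈ Set.Icc (0 : ℝ) d := by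
  refine ⟨Finset.sum_nonneg fun i _ => abs_nonneg _, ?_⟩
  calc l1Dist x y ≤ ∑ _i : Fin d, (1 : ℝ) := Finset.sum_le_sum fun i _ => by
        rw [abs_le]
        constructor <;> linarith [(hx i).1, (hx i).2, (hy i).1, (hy i).2]
    _ = d := by simp

open MeasureTheory in
theorem integrable_latticeRound {d : ℕ} (n : ℕ) (u : Fin d → ℝ)
    (h : (Fin d → Fin (n + 1)) → ℝ) :
    Integrable (fun t => h (latticeRound n u t)) thresholdMeasure :=
  integrable_comp_finite thresholdMeasure (measurable_latticeRound n u) h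

open MeasureTheory in
theorem integral_latticeRound {d n : ℕ} {u : Fin d → ℝ} {i : Fin d} (hu : 0 ≤ u i ∧ u i ≤ n) :
    ∫ t, ((latticeRound n u t i : ℕ) : ℝ) ∂thresholdMeasure = u i := by
  rw [← integral_thresholdRound (u i)]
  refine integral_congr_ae ?_
  filter_upwards [ae_thresholdMeasure] with t ht
  exact coe_real_latticeRound ht hu

-- With a common threshold the difference keeps one sign for almost every `t`, so the absolute value
-- leaves the integral and unbiasedness finishes.
open MeasureTheory in
theorem integral_abs_latticeRound_sub {d n : ℕ} {u u' : Fin d → ℝ} {i : Fin d}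
    (hu : 0 ≤ u i ∧ u i ≤ n) (hu' : 0 ≤ u' i ∧ u' i ≤ n) :
    ∫ t, |((latticeRound n u t i : ℕ) : ℝ) - (latticeRound n u' t i : ℕ)| ∂thresholdMeasure
      = |u i - u' i| := by
  wlog h : u i ≤ u' i generalizing u u'
  · rw [abs_sub_comm (u i), ← this hu' hu (le_of_not_ge h)]
    simp_rw [abs_sub_comm]
  rw [abs_sub_comm (u i), abs_of_nonneg (sub_nonneg.2 h), ← integral_latticeRound hu,
    ← integral_latticeRound hu', ← integral_sub
      (integrable_latticeRound n u' fun y => ((y i : ℕ) : ℝ))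
      (integrable_latticeRound n u fun y => ((y i : ℕ) : ℝ))]
  refine integral_congr_ae ?_
  filter_upwards [ae_thresholdMeasure] with t ht
  rw [abs_sub_comm, abs_of_nonneg]
  rw [coe_real_latticeRound ht hu, coe_real_latticeRound ht hu', sub_nonneg]
  exact_mod_cast thresholdRound_mono t h

open MeasureTheory in
theorem integral_l1Dist_gridPoint_latticeRound {d n : ℕ} (hn : 0 < n) {x x' : Fin d → ℝ}
    (hx : x ∈ unitCube d) (hx' : x' ∈ unitCube d) :
    ∫ t, l1Dist (gridPoint n (latticeRound n (fun i => (n : ℝ) * x i) t))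
        (gridPoint n (latticeRound n (fun i => (n : ℝ) * x' i) t)) ∂thresholdMeasure
      = l1Dist x x' := by
  have hn' : (0 : ℝ) < n := Nat.cast_pos.2 hn
  unfold l1Dist gridPoint
  simp_rw [← sub_div, abs_div, abs_of_pos hn']
  rw [integral_finsetSum]
  · refine Finset.sum_congr rfl fun i _ => ?_
    rw [integral_div, integral_abs_latticeRound_sub (scaled_mem_of_mem_unitCube n hx i)
      (scaled_mem_of_mem_unitCube n hx' i), ← mul_sub, abs_mul, abs_of_pos hn',
      mul_div_cancel_left₀ _ hn'.ne']
  · intro i _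
    exact integrable_comp_finite thresholdMeasure
      ((measurable_latticeRound n _).prodMk (measurable_latticeRound n _))
      fun p : (Fin d → Fin (n + 1)) × (Fin d → Fin (n + 1)) =>
        |((p.1 i : ℕ) : ℝ) - (p.2 i : ℕ)| / n

open MeasureTheory in
theorem integral_l1Dist_latticeRound_le {d n : ℕ} (hn : 0 < n) {x : Fin d → ℝ}
    (hx : x ∈ unitCube d) :
    ∫ t, l1Dist x (gridPoint n (latticeRound n (fun i => (n : ℝ) * x i) t)) ∂thresholdMeasure
      ≤ d / (2 * n) := by
  have hn' : (0 : ℝ) < n := Nat.cast_pos.2 hn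
  unfold l1Dist gridPoint
  rw [integral_finsetSum]
  · calc _ ≤ ∑ _i : Fin d, (1 : ℝ) / 2 / n := Finset.sum_le_sum fun i _ => ?_
      _ = d / (2 * n) := by simp; ring
    refine le_of_eq_of_le ?_ (div_le_div_of_nonneg_right
      (integral_abs_sub_thresholdRound_le ((n : ℝ) * x i)) hn'.le)
    rw [← integral_div]
    refine integral_congr_ae ?_
    filter_upwards [ae_thresholdMeasure] with t ht
    rw [coe_real_latticeRound ht (scaled_mem_of_mem_unitCube n hx i)]
    rw [← abs_of_pos hn', ← abs_div, abs_of_pos hn', sub_div, mul_div_cancel_left₀ _ hn'.ne']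
  · intro i _
    exact integrable_latticeRound n _ fun y => |x i - ((y i : ℕ) : ℝ) / n|

open MeasureTheory in
theorem isRegularOn_hatInterpolant {d n : ℕ} (hn : 0 < n) {ω : ℝ → ℝ}
    (hω : IsModulusOfRegularity (Set.Icc 0 (d : ℝ)) ω) {f : (Fin d → ℝ) → ℝ}
    (hf : IsRegularOn ω (unitCube d) f) :
    IsRegularOn ω (unitCube d) (hatInterpolant n (encoder n f)) := by
  intro x hx x' hx'
  have hP := (measurable_latticeRound n fun i => (n : ℝ) * x i).prodMk
    (measurable_latticeRound n fun i => (n : ℝ) * x' i)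
  rw [hatInterpolant_eq_integral _ hx, hatInterpolant_eq_integral _ hx',
    ← integral_sub (integrable_latticeRound n _ _) (integrable_latticeRound n _ _)]
  refine abs_integral_le_integral_abs.trans ?_
  rw [← integral_l1Dist_gridPoint_latticeRound hn hx hx']
  refine le_trans (integral_mono
    (integrable_comp_finite thresholdMeasure hP
      fun p : (Fin d → Fin (n + 1)) × (Fin d → Fin (n + 1)) => |encoder n f p.1 - encoder n f p.2|)
    (integrable_comp_finite thresholdMeasure hP
      fun p => ω (l1Dist (gridPoint n p.1) (gridPoint n p.2)))
    fun t => hf _ (gridPoint_mem_unitCube _) _ (gridPoint_mem_unitCube _)) ?_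
  exact hω.concaveOn.integral_comp_finite_le thresholdMeasure hP
    (fun p => l1Dist (gridPoint n p.1) (gridPoint n p.2))
    fun p => l1Dist_mem_Icc (gridPoint_mem_unitCube _) (gridPoint_mem_unitCube _)

open MeasureTheory in
theorem abs_sub_hatInterpolant_le {d n : ℕ} (hn : 0 < n) {ω : ℝ → ℝ}
    (hω : IsModulusOfRegularity (Set.Icc 0 (d : ℝ)) ω) {f : (Fin d → ℝ) → ℝ}
    (hf : IsRegularOn ω (unitCube d) f) {x : Fin d → ℝ} (hx : x ∈ unitCube d) :
    |f x - hatInterpolant n (encoder n f) x| ≤ ω ((d : ℝ) / (2 * n)) := by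
  have hP := measurable_latticeRound n fun i => (n : ℝ) * x i
  have hx1 : f x = ∫ _t, f x ∂thresholdMeasure := by simp
  rw [hatInterpolant_eq_integral _ hx, hx1,
    ← integral_sub (integrable_const _) (integrable_latticeRound n _ _)]
  refine abs_integral_le_integral_abs.trans ?_
  refine le_trans (integral_mono
    (integrable_latticeRound n _ fun y => |f x - encoder n f y|)
    (integrable_latticeRound n _ fun y => ω (l1Dist x (gridPoint n y)))
    fun t => hf _ hx _ (gridPoint_mem_unitCube _)) ?_
  refine (hω.concaveOn.integral_comp_finite_le thresholdMeasure hP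
    (fun y => l1Dist x (gridPoint n y))
    fun y => l1Dist_mem_Icc hx (gridPoint_mem_unitCube _)).trans ?_
  have hle := integral_l1Dist_latticeRound_le hn hx
  have hn1 : (1 : ℝ) ≤ n := Nat.one_le_cast.2 hn
  -- `ω` is monotone only on `[0, d]`, so `d / (2 n)` must be placed there; this uses `n ≥ 1`.
  have hd : (d : ℝ) / (2 * n) ≤ d := div_le_self d.cast_nonneg (by linarith)
  have h0 : 0 ≤ ∫ t, l1Dist x (gridPoint n (latticeRound n (fun i => (n : ℝ) * x i) t))
      ∂thresholdMeasure :=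
    integral_nonneg fun t => (l1Dist_mem_Icc hx (gridPoint_mem_unitCube _)).1
  exact hω.monotoneOn ⟨h0, hle.trans hd⟩ ⟨by positivity, hd⟩ hle

open MeasureTheory in
theorem hatInterpolant_gridPoint {d n : ℕ} (hn : 0 < n) (v : (Fin d → Fin (n + 1)) → ℝ)
    (y : Fin d → Fin (n + 1)) : hatInterpolant n v (gridPoint n y) = v y := by
  have hn' : (n : ℝ) ≠ 0 := Nat.cast_ne_zero.2 hn.ne'
  rw [hatInterpolant_eq_integral v (gridPoint_mem_unitCube y)]
  have : (fun t => v (latticeRound n (fun i => (n : ℝ) * gridPoint n y i) t))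
      =ᵐ[thresholdMeasure] fun _ => v y := by
    filter_upwards [ae_thresholdMeasure] with t ht
    congr 1
    rw [latticeRound_eq_iff ht (scaled_mem_of_mem_unitCube n (gridPoint_mem_unitCube y))]
    simp only [gridPoint, mul_div_cancel₀ _ hn', sub_self, abs_zero]
    exact ⟨fun _ _ => ht.1, fun _ _ => sub_pos.2 ht.2⟩
  rw [integral_congr_ae this]
  simp

theorem hat_eq_zero {d : ℕ} {y : Fin d → ℕ} {x : Fin d → ℝ} {i : Fin d} (h : 1 ≤ |x i - y i|) :
    hat y x = 0 := by
  unfold hat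
  have hE : 0 ≤ (Finset.univ.filter fun i => Even (y i)).fold max 0 (fun i => |x i - y i|) :=
    Finset.le_fold_max 0 |>.2 (Or.inl le_rfl)
  have hO : 0 ≤ (Finset.univ.filter fun i => Odd (y i)).fold max 0 (fun i => |x i - y i|) :=
    Finset.le_fold_max 0 |>.2 (Or.inl le_rfl)
  refine max_eq_left ?_
  rcases Nat.even_or_odd (y i) with hy | hy
  · have := (Finset.le_fold_max (s := Finset.univ.filter fun i => Even (y i))
      (f := fun i => |x i - y i|) (b := 0) 1).2 (Or.inr ⟨i, by simp [hy], h⟩)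
    linarith
  · have := (Finset.le_fold_max (s := Finset.univ.filter fun i => Odd (y i))
      (f := fun i => |x i - y i|) (b := 0) 1).2 (Or.inr ⟨i, by simp [hy], h⟩)
    linarith

theorem mem_of_hatInterpolant_ne_zero {d n : ℕ} (hn : 0 < n) (v : (Fin d → Fin (n + 1)) → ℝ)
    {x : Fin d → ℝ} (hx : hatInterpolant n v x ≠ 0) (i : Fin d) :
    -(1 / (n : ℝ)) ≤ x i ∧ x i ≤ 1 + 1 / (n : ℝ) := by
  have hn' : (0 : ℝ) < n := Nat.cast_pos.2 hn
  obtain ⟨y, -, hy⟩ := Finset.exists_ne_zero_of_sum_ne_zero hx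
  have h : |(n : ℝ) * x i - (y i : ℕ)| < 1 := by
    by_contra! h
    exact hy (by rw [hat_eq_zero h, mul_zero])
  obtain ⟨h1, h2⟩ := abs_lt.1 h
  have hy0 : (0 : ℝ) ≤ (y i : ℕ) := Nat.cast_nonneg _
  have hy1 : ((y i : ℕ) : ℝ) ≤ n := by exact_mod_cast Nat.lt_succ_iff.1 (y i).2
  constructor
  · rw [neg_le_iff_add_nonneg, ← mul_nonneg_iff_of_pos_left hn', mul_add,
      mul_one_div_cancel hn'.ne']
    linarith
  · rw [← sub_nonneg, ← mul_nonneg_iff_of_pos_left hn', mul_sub, mul_add,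
      mul_one_div_cancel hn'.ne']
    linarith

theorem continuous_fold_max {ι X : Type*} [TopologicalSpace X] (s : Finset ι) {f : ι → X → ℝ}
    (hf : ∀ i, Continuous (f i)) : Continuous fun x => s.fold max 0 (fun i => f i x) := by
  classical
  induction s using Finset.induction_on with
  | empty => simpa using continuous_const
  | insert a s ha ih =>
    simp_rw [Finset.fold_insert ha]
    exact (hf a).max ih

theorem continuous_hat {d : ℕ} (y : Fin d → ℕ) : Continuous (hat y) := by
  have h : ∀ i : Fin d, Continuous fun x : Fin d → ℝ => |x i - y i| := fun i => by fun_prop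
  exact continuous_const.max ((continuous_const.sub (continuous_fold_max _ h)).sub
    (continuous_fold_max _ h))

theorem continuous_hatInterpolant {d : ℕ} (n : ℕ) (v : (Fin d → Fin (n + 1)) → ℝ) :
    Continuous (hatInterpolant n v) :=
  continuous_finsetSum _ fun y _ => continuous_const.mul
    ((continuous_hat _).comp (by fun_prop))

/-! ### Affinity on the Kuhn simplices. -/

/-- `g` agrees on `S` with an affine function. -/
def IsAffineOn {d : ℕ} (S : Set (Fin d → ℝ)) (g : (Fin d → ℝ) → ℝ) : Prop :=
  ∃ A : (Fin d → ℝ) →ᵃ[ℝ] ℝ, Set.EqOn g A S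

namespace IsAffineOn

variable {d : ℕ} {S : Set (Fin d → ℝ)} {g h : (Fin d → ℝ) → ℝ}

theorem const (c : ℝ) : IsAffineOn S fun _ => c :=
  ⟨AffineMap.const ℝ _ c, fun _ _ => rfl⟩

theorem coord (i : Fin d) : IsAffineOn S fun x => x i :=
  ⟨(LinearMap.proj i : (Fin d → ℝ) →ₗ[ℝ] ℝ).toAffineMap, fun _ _ => rfl⟩

theorem sub (hg : IsAffineOn S g) (hh : IsAffineOn S h) : IsAffineOn S fun x => g x - h x := by
  obtain ⟨A, hA⟩ := hg
  obtain ⟨B, hB⟩ := hh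
  exact ⟨A - B, fun x hx => by simp [hA hx, hB hx]⟩

theorem const_mul (c : ℝ) (hg : IsAffineOn S g) : IsAffineOn S fun x => c * g x := by
  obtain ⟨A, hA⟩ := hg
  exact ⟨c • A, fun x hx => by simp [hA hx]⟩

theorem add (hg : IsAffineOn S g) (hh : IsAffineOn S h) : IsAffineOn S fun x => g x + h x := by
  obtain ⟨A, hA⟩ := hg
  obtain ⟨B, hB⟩ := hh
  exact ⟨A + B, fun x hx => by simp [hA hx, hB hx]⟩

theorem sum {ι : Type*} (s : Finset ι) {g : ι → (Fin d → ℝ) → ℝ} (hg : ∀ i, IsAffineOn S (g i)) :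
    IsAffineOn S fun x => ∑ i ∈ s, g i x := by
  classical
  induction s using Finset.induction_on with
  | empty => simpa using const 0
  | insert a s ha ih =>
    simp_rw [Finset.sum_insert ha]
    exact (hg a).add ih

theorem congr (hg : IsAffineOn S g) (hgh : ∀ x ∈ S, h x = g x) : IsAffineOn S h := by
  obtain ⟨A, hA⟩ := hg
  exact ⟨A, fun x hx => (hgh x hx).trans (hA hx)⟩

theorem relu_of_nonneg (hg : IsAffineOn S g) (h0 : ∀ x ∈ S, 0 ≤ g x) :
    IsAffineOn S fun x => relu (g x) :=
  hg.congr fun x hx => max_eq_right (h0 x hx)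

theorem relu_of_nonpos (h0 : ∀ x ∈ S, g x ≤ 0) : IsAffineOn S fun x => relu (g x) :=
  (const 0).congr fun x hx => max_eq_left (h0 x hx)

end IsAffineOn

theorem kuhnVertex_apply {d : ℕ} (τ : Equiv.Perm (Fin d)) (k : Fin (d + 1)) (a : Fin d) :
    kuhnVertex τ k (τ a) = if (a : ℕ) < k then 1 else 0 := by
  simp [kuhnVertex, Finset.sum_apply, Pi.single_apply]

/-- The right-hand set is convex and contains the vertices; this inclusion is all that affinity
needs. -/
theorem kuhnSimplex_subset {d : ℕ} (τ : Equiv.Perm (Fin d)) :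
    kuhnSimplex τ ⊆ {z | (∀ i, z i ∈ Set.Icc (0 : ℝ) 1) ∧ ∀ a b, a ≤ b → z (τ b) ≤ z (τ a)} := by
  refine convexHull_min ?_ ?_
  · rintro _ ⟨k, rfl⟩
    refine ⟨fun i => ?_, fun a b hab => ?_⟩
    · obtain ⟨a, rfl⟩ := τ.surjective i
      rw [kuhnVertex_apply]
      split_ifs <;> simp
    · rw [kuhnVertex_apply, kuhnVertex_apply]
      have : (a : ℕ) ≤ b := hab
      split_ifs <;> first | omega | norm_num
  · intro z hz w hw s t hs ht hst
    refine ⟨fun i => convex_Icc (0 : ℝ) 1 (hz.1 i) (hw.1 i) hs ht hst, fun a b hab => ?_⟩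
    have h1 := mul_le_mul_of_nonneg_left (hz.2 a b hab) hs
    have h2 := mul_le_mul_of_nonneg_left (hw.2 a b hab) ht
    simpa using add_le_add h1 h2

theorem fold_max_eq_of_forall_le {ι : Type*} {s : Finset ι} {f : ι → ℝ} {i : ι} (hi : i ∈ s)
    (h0 : 0 ≤ f i) (h : ∀ j ∈ s, f j ≤ f i) : s.fold max 0 f = f i :=
  le_antisymm ((Finset.fold_max_le _).2 ⟨h0, h⟩) ((Finset.le_fold_max _).2 (Or.inr ⟨i, hi, le_rfl⟩))

/-- The coordinate of the inverse of `cellMap`. -/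
noncomputable def cellCoord {d : ℕ} (n : ℕ) (m : Fin d → ℕ) (i : Fin d) (x : Fin d → ℝ) : ℝ :=
  if Even (m i) then n * x i - m i else m i + 1 - n * x i

theorem cellCoord_cellMap {d n : ℕ} (hn : 0 < n) (m : Fin d → ℕ) (i : Fin d) (z : Fin d → ℝ) :
    cellCoord n m i (cellMap n m z) = z i := by
  have hn' : (n : ℝ) ≠ 0 := Nat.cast_ne_zero.2 hn.ne'
  unfold cellCoord cellMap
  split_ifs <;> field_simp <;> ring

theorem isAffineOn_cellCoord {d : ℕ} (S : Set (Fin d → ℝ)) (n : ℕ) (m : Fin d → ℕ) (i : Fin d) :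
    IsAffineOn S (cellCoord n m i) := by
  unfold cellCoord
  split_ifs
  · exact ((IsAffineOn.coord i).const_mul _).sub (.const _)
  · exact (IsAffineOn.const _).sub ((IsAffineOn.coord i).const_mul _)

/-- This is the point of the reflection: in each direction `cellCoord` is the distance to the even
end of the cell, whatever the parity of `m i`. -/
theorem abs_sub_eq_cellCoord {d n : ℕ} {m y : Fin d → ℕ} {i : Fin d} {x : Fin d → ℝ}
    (hx : cellCoord n m i x ∈ Set.Icc (0 : ℝ) 1) (hy : y i = m i ∨ y i = m i + 1) :
    |(n : ℝ) * x i - y i|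
      = if Even (y i) then cellCoord n m i x else 1 - cellCoord n m i x := by
  unfold cellCoord at hx ⊢
  rcases Nat.even_or_odd (m i) with hm | hm
  · rw [if_pos hm] at hx ⊢
    rcases hy with hy | hy
    · rw [hy, if_pos hm, abs_of_nonneg hx.1]
    · rw [hy, if_neg (by simpa [Nat.even_add_one] using hm), abs_of_nonpos] <;> push_cast <;>
        linarith [hx.1, hx.2]
  · have hm' : ¬ Even (m i) := Nat.not_even_iff_odd.2 hm
    rw [if_neg hm'] at hx ⊢
    rcases hy with hy | hy
    · rw [hy, if_neg hm', abs_of_nonneg] <;> linarith [hx.1, hx.2]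
    · rw [hy, if_pos (by simpa [Nat.even_add_one] using hm), abs_of_nonpos] <;> push_cast <;>
        linarith [hx.1, hx.2]

theorem one_le_abs_sub_of_cellCoord {d n : ℕ} {m y : Fin d → ℕ} {i : Fin d} {x : Fin d → ℝ}
    (hx : cellCoord n m i x ∈ Set.Icc (0 : ℝ) 1) (hy : ¬ (y i = m i ∨ y i = m i + 1)) :
    1 ≤ |(n : ℝ) * x i - y i| := by
  have h : (m i : ℝ) ≤ n * x i ∧ (n : ℝ) * x i ≤ m i + 1 := by
    unfold cellCoord at hx
    split_ifs at hx <;> constructor <;> linarith [hx.1, hx.2]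
  rcases lt_or_ge (y i) (m i) with hlt | hge
  · have : (y i : ℝ) + 1 ≤ m i := by exact_mod_cast hlt
    exact le_abs.2 (Or.inl (by linarith))
  · have : (m i : ℝ) + 2 ≤ y i := by exact_mod_cast (by omega : m i + 2 ≤ y i)
    exact le_abs.2 (Or.inr (by linarith))

theorem exists_mem_perm_min {d : ℕ} (τ : Equiv.Perm (Fin d)) {s : Finset (Fin d)}
    (hs : s.Nonempty) : ∃ a, τ a ∈ s ∧ ∀ j ∈ s, ∃ b, a ≤ b ∧ τ b = j := by
  obtain ⟨i, hi, hmin⟩ := s.exists_min_image τ.symm hs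
  exact ⟨τ.symm i, by simpa, fun j hj => ⟨τ.symm j, hmin j hj, by simp⟩⟩

theorem exists_mem_perm_max {d : ℕ} (τ : Equiv.Perm (Fin d)) {s : Finset (Fin d)}
    (hs : s.Nonempty) : ∃ a, τ a ∈ s ∧ ∀ j ∈ s, ∃ b, b ≤ a ∧ τ b = j := by
  obtain ⟨i, hi, hmax⟩ := s.exists_max_image τ.symm hs
  exact ⟨τ.symm i, by simpa, fun j hj => ⟨τ.symm j, hmax j hj, by simp⟩⟩

/-- Cell coordinates decrease along `τ`. The even maximum therefore sits at the `τ`-first even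
coordinate `a` and the odd one at the `τ`-last odd coordinate `b`; the argument of `relu` becomes
the difference of the cell coordinates at `τ b` and `τ a`, of constant sign. -/
theorem isAffineOn_hat {d n : ℕ} (hn : 0 < n) (m : Fin d → ℕ) (τ : Equiv.Perm (Fin d))
    (y : Fin d → ℕ) :
    IsAffineOn (cellMap n m '' kuhnSimplex τ) fun x => hat y (fun i => (n : ℝ) * x i) := by
  have hS : ∀ x ∈ cellMap n m '' kuhnSimplex τ, (∀ i, cellCoord n m i x ∈ Set.Icc (0 : ℝ) 1) ∧
      ∀ a b, a ≤ b → cellCoord n m (τ b) x ≤ cellCoord n m (τ a) x := by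
    rintro _ ⟨z, hz, rfl⟩
    simp only [cellCoord_cellMap hn]
    exact kuhnSimplex_subset τ hz
  generalize cellMap n m '' kuhnSimplex τ = S at hS
  by_cases hy : ∀ i, y i = m i ∨ y i = m i + 1
  swap
  · obtain ⟨i, hi⟩ := not_forall.1 hy
    exact (IsAffineOn.const 0).congr fun x hx =>
      hat_eq_zero (i := i) (one_le_abs_sub_of_cellCoord ((hS x hx).1 i) hi)
  set E := Finset.univ.filter fun i => Even (y i) with hE
  set O := Finset.univ.filter fun i => Odd (y i) with hO
  have hfoldE : ∀ a, τ a ∈ E → (∀ j ∈ E, ∃ b, a ≤ b ∧ τ b = j) → ∀ x ∈ S,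
      E.fold max 0 (fun i => |(n : ℝ) * x i - y i|) = cellCoord n m (τ a) x := by
    intro a ha hmin x hx
    have e : ∀ j ∈ E, |(n : ℝ) * x j - y j| = cellCoord n m j x := fun j hj => by
      rw [abs_sub_eq_cellCoord ((hS x hx).1 j) (hy j), if_pos (by simpa [hE] using hj)]
    rw [fold_max_eq_of_forall_le ha (abs_nonneg _), e _ ha]
    intro j hj
    rw [e j hj, e _ ha]
    obtain ⟨b, hab, rfl⟩ := hmin j hj
    exact (hS x hx).2 a b hab
  have hfoldO : ∀ a, τ a ∈ O → (∀ j ∈ O, ∃ b, b ≤ a ∧ τ b = j) → ∀ x ∈ S,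
      O.fold max 0 (fun i => |(n : ℝ) * x i - y i|) = 1 - cellCoord n m (τ a) x := by
    intro a ha hmax x hx
    have e : ∀ j ∈ O, |(n : ℝ) * x j - y j| = 1 - cellCoord n m j x := fun j hj => by
      rw [abs_sub_eq_cellCoord ((hS x hx).1 j) (hy j),
        if_neg (Nat.not_even_iff_odd.2 (by simpa [hO] using hj))]
    rw [fold_max_eq_of_forall_le ha (abs_nonneg _), e _ ha]
    intro j hj
    rw [e j hj, e _ ha]
    obtain ⟨b, hab, rfl⟩ := hmax j hj
    exact sub_le_sub_left ((hS x hx).2 b a hab) 1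
  change IsAffineOn S fun x => relu (1 - E.fold max 0 (fun i => |(n : ℝ) * x i - y i|)
    - O.fold max 0 (fun i => |(n : ℝ) * x i - y i|))
  have hc := isAffineOn_cellCoord S n m
  rcases E.eq_empty_or_nonempty with hE0 | hE0 <;> rcases O.eq_empty_or_nonempty with hO0 | hO0
  · simp only [hE0, hO0, Finset.fold_empty]
    exact .const _
  · obtain ⟨b, hb, hbO⟩ := exists_mem_perm_max τ hO0
    refine IsAffineOn.congr (hc (τ b)) fun x hx => ?_
    rw [hfoldO b hb hbO x hx, hE0, Finset.fold_empty]
    simpa [relu] using ((hS x hx).1 (τ b)).1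
  · obtain ⟨a, ha, haE⟩ := exists_mem_perm_min τ hE0
    refine IsAffineOn.congr ((IsAffineOn.const 1).sub (hc (τ a))) fun x hx => ?_
    rw [hfoldE a ha haE x hx, hO0, Finset.fold_empty]
    simpa [relu] using ((hS x hx).1 (τ a)).2
  · obtain ⟨a, ha, haE⟩ := exists_mem_perm_min τ hE0
    obtain ⟨b, hb, hbO⟩ := exists_mem_perm_max τ hO0
    have e : ∀ x ∈ S, relu (1 - E.fold max 0 (fun i => |(n : ℝ) * x i - y i|)
        - O.fold max 0 (fun i => |(n : ℝ) * x i - y i|))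
        = relu (cellCoord n m (τ b) x - cellCoord n m (τ a) x) := fun x hx => by
      rw [hfoldE a ha haE x hx, hfoldO b hb hbO x hx]
      congr 1
      ring
    refine IsAffineOn.congr ?_ e
    rcases le_total a b with hab | hab
    · exact IsAffineOn.relu_of_nonpos fun x hx => sub_nonpos.2 ((hS x hx).2 a b hab)
    · exact ((hc (τ b)).sub (hc (τ a))).relu_of_nonneg fun x hx =>
        sub_nonneg.2 ((hS x hx).2 b a hab)

theorem isKuhnPiecewiseLinear_hatInterpolant {d n : ℕ} (hn : 0 < n)
    (v : (Fin d → Fin (n + 1)) → ℝ) : IsKuhnPiecewiseLinear n (hatInterpolant n v) :=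
  ⟨(continuous_hatInterpolant n v).continuousOn, fun _ τ =>
    IsAffineOn.sum _ fun y => (isAffineOn_hat hn _ τ _).const_mul (v y)⟩

/-! ### Assembling networks layer by layer. -/

/-- `F` is implemented on `S` by a network with one output whose inputs are indexed by `κ`, which
has `L` hidden layers, width at most `w`, at most `s` nonzero parameters, and parameters bounded
by `B`. -/
def IsRealizable {k : ℕ} {κ : Type*} (e : Fin k ≃ κ) (S : Set (κ → ℝ)) (L w s : ℕ) (B : ℝ)
    (F : (κ → ℝ) → ℝ) : Prop :=
  ∃ Φ : ReLUMLP k 1, Φ.depth = L ∧ Φ.width ≤ w ∧ Φ.numNonzero ≤ s ∧ Φ.parNorm ≤ B ∧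
    ∀ x ∈ S, Φ.toFun (x ∘ e) = F x

namespace IsRealizable

variable {k : ℕ} {κ : Type*} {e : Fin k ≃ κ} {S : Set (κ → ℝ)} {L w s : ℕ} {B : ℝ}

theorem mono {F : (κ → ℝ) → ℝ} (h : IsRealizable e S L w s B F) {s' : ℕ} (hs : s ≤ s') :
    IsRealizable e S L w s' B F := by
  obtain ⟨Φ, h1, h2, h3, h4, h5⟩ := h
  exact ⟨Φ, h1, h2, h3.trans hs, h4, h5⟩

theorem congr {F G : (κ → ℝ) → ℝ} (h : IsRealizable e S L w s B F) (hFG : ∀ x ∈ S, F x = G x) :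
    IsRealizable e S L w s B G := by
  obtain ⟨Φ, h1, h2, h3, h4, h5⟩ := h
  exact ⟨Φ, h1, h2, h3, h4, fun x hx => (h5 x hx).trans (hFG x hx)⟩

theorem output [Fintype κ] (hB : 0 ≤ B) (a : κ → ℝ) (ha : ∀ j, |a j| ≤ B) :
    IsRealizable e S 0 w (Fintype.card κ) B fun x => ∑ j, a j * x j := by
  refine ⟨.output (Matrix.of fun _ j => a (e j)) 0, rfl, Nat.zero_le _, ?_, ?_, fun x _ => ?_⟩
  · simp only [ReLUMLP.numNonzero, ReLUMLP.layerNonzero]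
    refine (add_le_add (Finset.card_le_univ _) (by simp : _ ≤ 0)).trans ?_
    simp [← Fintype.card_congr e]
  · simp only [ReLUMLP.parNorm, ReLUMLP.layerNorm]
    exact max_le ((pi_norm_le_iff_of_nonneg hB).2 fun p => ha _) (by simpa using hB)
  · simp only [ReLUMLP.toFun, ReLUMLP.eval, Matrix.mulVec, dotProduct, Pi.add_apply,
      Pi.zero_apply, add_zero, Function.comp_apply]
    exact Equiv.sum_comp e fun j => a j * x j

-- Prepends a layer. The inner network need only be correct on nonnegative vectors, since its inputs
-- are values of `relu`.
open Classical in
theorem hidden [Fintype κ] {ι : Type*} [Fintype ι] [Nonempty ι] (hB : 0 ≤ B) (W : ι → κ → ℝ)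
    (b : ι → ℝ) (hW : ∀ i j, |W i j| ≤ B) (hb : ∀ i, |b i| ≤ B) (hw : Fintype.card ι ≤ w)
    {s₁ s₂ : ℕ} (hs₁ : (Finset.univ.filter fun p : ι × κ => W p.1 p.2 ≠ 0).card ≤ s₁)
    (hs₂ : (Finset.univ.filter fun i => b i ≠ 0).card ≤ s₂) {G : (ι → ℝ) → ℝ}
    (h : IsRealizable (Fintype.equivFin ι).symm {z | ∀ i, 0 ≤ z i} L w s B G) :
    IsRealizable e S (L + 1) w (s₁ + s₂ + s) B
      fun x => G fun i => relu (∑ j, W i j * x j + b i) := by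
  obtain ⟨Φ, h1, h2, h3, h4, h5⟩ := h
  set e' := (Fintype.equivFin ι).symm
  refine ⟨.hidden Fintype.card_pos (Matrix.of fun i j => W (e' i) (e j)) (fun i => b (e' i)) Φ,
    congrArg (· + 1) h1, max_le hw h2, ?_, ?_, fun x _ => ?_⟩
  · simp only [ReLUMLP.numNonzero, ReLUMLP.layerNonzero]
    refine add_le_add (add_le_add (le_trans ?_ hs₁) (le_trans ?_ hs₂)) h3
    · exact Finset.card_le_card_of_injOn (Prod.map e' e) (fun p hp =>
        Finset.mem_coe.2 (Finset.mem_filter.2 ⟨Finset.mem_univ _,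
          (Finset.mem_filter.1 (Finset.mem_coe.1 hp)).2⟩)) ((e'.injective.prodMap e.injective).injOn)
    · exact Finset.card_le_card_of_injOn e' (by intro p hp; simpa using hp) e'.injective.injOn
  · simp only [ReLUMLP.parNorm, ReLUMLP.layerNorm]
    exact max_le (max_le ((pi_norm_le_iff_of_nonneg hB).2 fun p => hW _ _)
      ((pi_norm_le_iff_of_nonneg hB).2 fun p => hb _)) h4
  · refine Eq.trans ?_ (h5 (fun i => relu (∑ j, W i j * x j + b i)) fun i => le_max_left _ _)
    simp only [ReLUMLP.toFun, ReLUMLP.eval, Matrix.mulVec, dotProduct, Pi.add_apply,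
      Function.comp_apply]
    congr 2
    funext i
    simp only [Function.comp_apply]
    rw [← Equiv.sum_comp e fun j => W (e' i) j * x j]
    rfl

end IsRealizable

/-! ### Maxima by binary trees. -/

theorem relu_add_relu_neg (t : ℝ) : relu t + relu (-t) = |t| := by
  rcases le_total 0 t with h | h
  · rw [relu, relu, max_eq_right h, max_eq_left (by linarith), abs_of_nonneg h, add_zero]
  · rw [relu, relu, max_eq_left h, max_eq_right (by linarith), abs_of_nonpos h, zero_add]

/-- Two neurons suffice because `t ≥ 0`. Their sum is again nonnegative, so the construction
iterates, with each number stored as a pair of neurons. -/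
theorem relu_sub_add_relu {s t : ℝ} (ht : 0 ≤ t) : relu (s - t) + relu t = max s t := by
  rw [relu, relu, max_eq_right ht, max_add, zero_add, sub_add_cancel, max_comm]

/-- Neurons that encode, for every `a : α`, a list of `c a` numbers, each of which is the sum of
the values of two neurons. -/
abbrev Slot {α : Type*} (c : α → ℕ) : Type _ := Σ a : α, Fin (c a) × Bool

section Slot

variable {α : Type*} (c : α → ℕ)

/-- The `j`-th number of the list of `a`, and `0` beyond the end of the list. -/
def slotValue (x : Slot c → ℝ) (a : α) (j : ℕ) : ℝ :=
  if h : j < c a then x ⟨a, ⟨j, h⟩, false⟩ + x ⟨a, ⟨j, h⟩, true⟩ else 0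

/-- The maximum of `0` and the numbers in the list of `a`. -/
noncomputable def slotMax (x : Slot c → ℝ) (a : α) : ℝ :=
  (Finset.range (c a)).fold max 0 (slotValue c x a)

/-- The lengths of the lists after a round of pairwise maxima. -/
def halving (a : α) : ℕ := (c a + 1) / 2

theorem slotValue_nonneg {x : Slot c → ℝ} (hx : ∀ q, 0 ≤ x q) (a : α) (j : ℕ) :
    0 ≤ slotValue c x a j := by
  unfold slotValue
  split_ifs
  · exact add_nonneg (hx _) (hx _)
  · exact le_rfl

theorem card_slot [Fintype α] : Fintype.card (Slot c) = ∑ a, 2 * c a := by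
  simp [Slot, mul_comm]

theorem sum_fin_slot (x : Slot c → ℝ) (a : α) :
    ∑ p : Fin (c a) × Bool, x ⟨a, p⟩ = ∑ j ∈ Finset.range (c a), slotValue c x a j := by
  rw [Finset.sum_range, Fintype.sum_prod_type]
  refine Finset.sum_congr rfl fun j _ => ?_
  rw [slotValue, dif_pos j.2, Fintype.sum_bool, add_comm]

theorem slotMax_eq_sum {x : Slot c → ℝ} (hx : ∀ q, 0 ≤ x q) {a : α} (ha : c a ≤ 1) :
    slotMax c x a = ∑ p : Fin (c a) × Bool, x ⟨a, p⟩ := by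
  rw [sum_fin_slot, slotMax]
  obtain h | h : c a = 0 ∨ c a = 1 := by omega
  · simp [h]
  · rw [h, Finset.range_one, Finset.fold_singleton, Finset.sum_singleton]
    exact max_eq_left (slotValue_nonneg c hx a 0)

/-- The weights of the layer that replaces consecutive numbers `s`, `t` by the pair of neurons
`relu (s - t)`, `relu t`. -/
def halvingWeight [DecidableEq α] (p : Slot (halving c)) (q : Slot c) : ℝ :=
  if q.1 = p.1 then
    (if (q.2.1 : ℕ) = 2 * (p.2.1 : ℕ) then (if p.2.2 then 0 else 1) else 0) +
      (if (q.2.1 : ℕ) = 2 * (p.2.1 : ℕ) + 1 then (if p.2.2 then 1 else -1) else 0)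
  else 0

theorem sum_ite_mul_slot (x : Slot c → ℝ) (a : α) (k : ℕ) (r : ℝ) :
    ∑ p : Fin (c a) × Bool, (if (p.1 : ℕ) = k then r else 0) * x ⟨a, p⟩
      = r * slotValue c x a k := by
  rw [Fintype.sum_prod_type, slotValue]
  split_ifs with h
  · rw [Finset.sum_eq_single ⟨k, h⟩]
    · simp [mul_add, add_comm]
    · intro j _ hj
      have : (j : ℕ) ≠ k := fun h' => hj (Fin.ext h')
      simp [this]
    · simp
  · rw [mul_zero]
    refine Finset.sum_eq_zero fun j _ => ?_
    have : (j : ℕ) ≠ k := by omega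
    simp [this]

theorem sum_halvingWeight_mul [DecidableEq α] [Fintype α] (x : Slot c → ℝ) (p : Slot (halving c)) :
    ∑ q, halvingWeight c p q * x q
      = (if p.2.2 then 0 else 1) * slotValue c x p.1 (2 * p.2.1)
        + (if p.2.2 then 1 else -1) * slotValue c x p.1 (2 * p.2.1 + 1) := by
  rw [Fintype.sum_sigma, Finset.sum_eq_single p.1]
  · simp only [halvingWeight, if_true, add_mul, Finset.sum_add_distrib]
    rw [sum_ite_mul_slot, sum_ite_mul_slot]
  · intro a _ ha
    simp [halvingWeight, ha]
  · simp

theorem slotMax_halving [DecidableEq α] [Fintype α] {x : Slot c → ℝ} (hx : ∀ q, 0 ≤ x q) (a : α) :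
    slotMax (halving c) (fun p => relu (∑ q, halvingWeight c p q * x q + 0)) a
      = slotMax c x a := by
  have hv : ∀ j < halving c a,
      slotValue (halving c) (fun p => relu (∑ q, halvingWeight c p q * x q + 0)) a j
        = max (slotValue c x a (2 * j)) (slotValue c x a (2 * j + 1)) := by
    intro j hj
    rw [← relu_sub_add_relu (slotValue_nonneg c hx a _), slotValue, dif_pos hj,
      sum_halvingWeight_mul, sum_halvingWeight_mul]
    simp [sub_eq_add_neg]
  refine eq_of_forall_ge_iff fun t => ?_
  rw [slotMax, slotMax, Finset.fold_max_le, Finset.fold_max_le]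
  refine and_congr_right fun ht => ?_
  simp only [Finset.mem_range]
  constructor
  · intro h j hj
    have hj' : j / 2 < halving c a := by unfold halving; omega
    have h2 := h _ hj'
    rw [hv _ hj', max_le_iff] at h2
    rcases Nat.even_or_odd' j with ⟨i, rfl | rfl⟩
    · simpa using h2.1
    · rw [show (2 * i + 1) / 2 = i by omega] at h2
      exact h2.2
  · intro h j hj
    -- For a list of odd length `2 * j + 1` may overrun the end; the padding value `0` is also at
    -- most `t`.
    have hall : ∀ i, slotValue c x a i ≤ t := by
      intro i
      by_cases hi : i < c a
      · exact h i hi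
      · rwa [slotValue, dif_neg hi]
    rw [hv _ hj]
    exact max_le (hall _) (hall _)

theorem sum_range_one_add_mod_two (m : ℕ) : ∑ j ∈ Finset.range m, (1 + j % 2) = m + m / 2 := by
  induction m with
  | zero => rfl
  | succ m ih =>
    rw [Finset.sum_range_succ, ih]
    omega

-- An input neuron at an even position feeds only `relu (s - t)`, one at an odd position feeds both
-- neurons of its pair: `1 + j % 2` connections from each of the two neurons at position `j`.
open Classical in
theorem card_halvingWeight_ne_zero_le [DecidableEq α] [Fintype α] :
    (Finset.univ.filter fun p : Slot (halving c) × Slot c => halvingWeight c p.1 p.2 ≠ 0).card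
      ≤ ∑ a, 2 * (c a + c a / 2) := by
  have hsupp : ∀ p q, halvingWeight c p q ≠ 0 →
      q.1 = p.1 ∧ (p.2.1 : ℕ) = (q.2.1 : ℕ) / 2 ∧ (p.2.2 = true → (q.2.1 : ℕ) % 2 = 1) := by
    intro p q h
    unfold halvingWeight at h
    by_cases h1 : q.1 = p.1
    swap
    · simp [h1] at h
    by_cases h2 : (q.2.1 : ℕ) = 2 * (p.2.1 : ℕ)
    · refine ⟨h1, by omega, fun h3 => ?_⟩
      simp [h1, h2, h3] at h
    · by_cases h3 : (q.2.1 : ℕ) = 2 * (p.2.1 : ℕ) + 1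
      · exact ⟨h1, by omega, fun _ => by omega⟩
      · simp [h2, h3] at h
  calc _ ≤ (Finset.univ.filter fun r : Slot c × Bool =>
        r.2 = true → (r.1.2.1 : ℕ) % 2 = 1).card := by
        refine Finset.card_le_card_of_injOn (fun p => (p.2, p.1.2.2)) ?_ ?_
        · intro p hp
          simpa using (hsupp p.1 p.2 (by simpa using hp)).2.2
        · rintro ⟨⟨a, j, s⟩, q⟩ hp ⟨⟨a', j', s'⟩, q'⟩ hp' hpp
          obtain ⟨rfl, rfl⟩ : q = q' ∧ s = s' := by simpa using hpp
          obtain ⟨h1, h2, -⟩ := hsupp _ _ (by simpa using hp)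
          obtain ⟨h1', h2', -⟩ := hsupp _ _ (by simpa using hp')
          dsimp only at h1 h1' h2 h2'
          obtain rfl : a = a' := h1.symm.trans h1'
          obtain rfl : j = j' := Fin.ext (h2.trans h2'.symm)
          rfl
    _ = ∑ a, 2 * (c a + c a / 2) := by
        rw [Finset.card_filter, Fintype.sum_prod_type, Fintype.sum_sigma]
        refine Finset.sum_congr rfl fun a _ => ?_
        rw [← sum_range_one_add_mod_two, Finset.sum_range, Fintype.sum_prod_type, Finset.mul_sum]
        refine Finset.sum_congr rfl fun j _ => ?_
        rcases Nat.mod_two_eq_zero_or_one j with h | h <;> simp [h]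

end Slot

open Classical in
/-- A network which computes the maxima of nonnegative lists, and the corresponding combination of
hat functions. -/
theorem isRealizable_sum_relu_slotMax {Y : Type*} [Fintype Y] [Nonempty Y] {B : ℝ} (hB : 1 ≤ B)
    (v : Y → ℝ) (hv : ∀ y, |v y| ≤ B) {w : ℕ} (L : ℕ) :
    ∀ (c : Y × Bool → ℕ) {k : ℕ} (e : Fin k ≃ Slot c), (∃ a, 0 < c a) → (∀ a, c a ≤ 2 ^ L) →
      ∑ a, (c a + 1) ≤ w →
      IsRealizable e {x | ∀ q, 0 ≤ x q} (L + 1) w (∑ a, (6 * c a + 2 * L) + 2 * Fintype.card Y) B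
        fun x => ∑ y, v y * relu (1 - slotMax c x (y, false) - slotMax c x (y, true)) := by
  have hB0 : 0 ≤ B := zero_le_one.trans hB
  induction L with
  | zero =>
    intro c k e _ hc hw
    have hYw : Fintype.card Y ≤ w := by
      have h : ∑ _a : Y × Bool, 1 ≤ ∑ a, (c a + 1) := Finset.sum_le_sum fun a _ => by omega
      rw [Finset.sum_const, Finset.card_univ, Fintype.card_prod, Fintype.card_bool,
        smul_eq_mul] at h
      omega
    have hnz : (Finset.univ.filter fun p : Y × Slot c =>
        (if p.2.1.1 = p.1 then (-1 : ℝ) else 0) ≠ 0).card ≤ ∑ a, 2 * c a := by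
      rw [← card_slot c, ← Finset.card_univ]
      refine Finset.card_le_card_of_injOn Prod.snd (fun _ _ => Finset.mem_coe.2 (Finset.mem_univ _))
        ?_
      rintro ⟨y, q⟩ hp ⟨y', q'⟩ hp' hpp
      obtain rfl : q = q' := hpp
      have h1 : q.1.1 = y := by simpa using hp
      have h2 : q.1.1 = y' := by simpa using hp'
      rw [← h1, ← h2]
    -- Lists now have length at most one, so the maximum is a plain sum: weights `-1` and bias `1`
    -- produce the hat, and `v` is the output row.
    refine ((IsRealizable.hidden hB0 (fun (y : Y) (q : Slot c) => if q.1.1 = y then (-1 : ℝ) else 0)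
      (fun _ => 1) ?_ (fun _ => by simpa using hB) hYw hnz (Finset.card_le_univ _)
      (.output hB0 v hv)).mono ?_).congr ?_
    · intro y q
      split_ifs
      · simpa using hB
      · simpa using hB0
    · have : ∑ a, 2 * c a ≤ ∑ a, (6 * c a + 2 * 0) :=
        Finset.sum_le_sum fun a _ => by omega
      omega
    · intro x hx
      refine Finset.sum_congr rfl fun y _ => ?_
      congr 1
      change relu _ = relu _
      congr 1
      rw [slotMax_eq_sum c hx (by simpa using hc _), slotMax_eq_sum c hx (by simpa using hc _),
        Fintype.sum_sigma, Fintype.sum_prod_type, Finset.sum_eq_single y]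
      · simp only [if_true, Fintype.sum_bool, neg_mul, one_mul, Finset.sum_neg_distrib]
        ring
      · intro y' _ hy'
        simp [hy']
      · simp
  | succ L ih =>
    intro c k e hpos hc hw
    -- Hidden layers must be nonempty, so a nonempty list is carried along.
    have hpos' : ∃ a, 0 < halving c a := hpos.imp fun a ha => by unfold halving; omega
    have hc' : ∀ a, halving c a ≤ 2 ^ L := fun a => by
      have := hc a
      unfold halving
      omega
    have hw' : ∑ a, (halving c a + 1) ≤ w :=
      (Finset.sum_le_sum fun a _ => by
        rcases Nat.eq_zero_or_pos (c a) with h | h <;> unfold halving <;> omega).trans hw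
    have hcard : Fintype.card (Slot (halving c)) ≤ w := by
      rw [card_slot]
      exact (Finset.sum_le_sum fun a _ => by unfold halving; omega).trans hw
    have : Nonempty (Slot (halving c)) := by
      obtain ⟨a, ha⟩ := hpos'
      exact ⟨⟨a, ⟨0, ha⟩, false⟩⟩
    refine ((IsRealizable.hidden (s₂ := 0) hB0 (halvingWeight c) (fun _ => 0) ?_ (by simpa using hB0)
      hcard (card_halvingWeight_ne_zero_le c) (by simp)
      (ih (halving c) _ hpos' hc' hw')).mono ?_).congr ?_
    · intro p q
      unfold halvingWeight
      split_ifs <;> first | omega | simpa using hB | simpa using hB0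
    -- For even `c a` the layer costs exactly what halving saves; for odd `c a` rounding up costs
    -- `2` more, which the term `2 * L` pays.
    · have : ∑ a, 2 * (c a + c a / 2) + ∑ a, (6 * halving c a + 2 * L)
          ≤ ∑ a, (6 * c a + 2 * (L + 1)) := by
        rw [← Finset.sum_add_distrib]
        exact Finset.sum_le_sum fun a _ => by unfold halving; omega
      omega
    · intro x hx
      refine Finset.sum_congr rfl fun y _ => ?_
      rw [slotMax_halving c hx, slotMax_halving c hx]

/-! ### The network of the interpolant. -/

/-- The coordinates of `y` that are even, or odd. -/
def parityCoords {d : ℕ} (y : Fin d → ℕ) : Bool → Finset (Fin d)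
  | false => Finset.univ.filter fun i => Even (y i)
  | true => Finset.univ.filter fun i => Odd (y i)

theorem card_parityCoords_add {d : ℕ} (y : Fin d → ℕ) :
    (parityCoords y true).card + (parityCoords y false).card = d := by
  simp only [parityCoords, ← Nat.not_even_iff_odd]
  rw [add_comm, Finset.card_filter_add_card_filter_not, Finset.card_fin]

/-- The number of coordinates of the given parity of a lattice point. -/
def parityCount (d n : ℕ) (a : (Fin d → Fin (n + 1)) × Bool) : ℕ :=
  (parityCoords (fun i => (a.1 i : ℕ)) a.2).card

/-- The coordinate that belongs to a slot. -/
def parityEnum {d n : ℕ} (a : (Fin d → Fin (n + 1)) × Bool) : Fin (parityCount d n a) ↪o Fin d :=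
  (parityCoords (fun i => (a.1 i : ℕ)) a.2).orderEmbOfFin rfl

theorem slotMax_abs {d n : ℕ} (u : Fin d → ℝ) (a : (Fin d → Fin (n + 1)) × Bool)
    {x : Slot (parityCount d n) → ℝ}
    (hx : ∀ j : Fin (parityCount d n a), x ⟨a, j, false⟩ + x ⟨a, j, true⟩
      = |u (parityEnum a j) - (a.1 (parityEnum a j) : ℕ)|) :
    slotMax (parityCount d n) x a
      = (parityCoords (fun i => (a.1 i : ℕ)) a.2).fold max 0 (fun i => |u i - (a.1 i : ℕ)|) := by
  refine eq_of_forall_ge_iff fun t => ?_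
  rw [slotMax, Finset.fold_max_le, Finset.fold_max_le]
  refine and_congr_right fun _ => ?_
  have hmem : ∀ i, i ∈ parityCoords (fun i => (a.1 i : ℕ)) a.2 ↔ ∃ j, parityEnum a j = i := by
    intro i
    rw [← Finset.mem_coe, ← Finset.range_orderEmbOfFin _ rfl]
    rfl
  simp only [hmem, Finset.mem_range]
  constructor
  · rintro h _ ⟨j, rfl⟩
    have := h j j.2
    rwa [slotValue, dif_pos j.2, hx] at this
  · intro h j hj
    rw [slotValue, dif_pos hj, hx]
    exact h _ ⟨⟨j, hj⟩, rfl⟩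

theorem sum_parityCount (d n : ℕ) : ∑ a, parityCount d n a = d * (n + 1) ^ d := by
  rw [Fintype.sum_prod_type]
  simp only [Fintype.sum_bool, parityCount, card_parityCoords_add]
  simp [mul_comm]

open Classical in
theorem isRealizable_hatInterpolant {d n : ℕ} (hd : 0 < d) (hn : 0 < n)
    (v : (Fin d → Fin (n + 1)) → ℝ) :
    IsRealizable (Equiv.refl (Fin d)) Set.univ (Nat.clog 2 d + 2) (8 * d * (n + 1) ^ d)
      (16 * d * (n + 1) ^ d) (max (n : ℝ) ‖v‖) (hatInterpolant n v) := by
  have hn1 : (1 : ℝ) ≤ n := Nat.one_le_cast.2 hn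
  have hnB : (n : ℝ) ≤ max (n : ℝ) ‖v‖ := le_max_left _ _
  have hB1 : (1 : ℝ) ≤ max (n : ℝ) ‖v‖ := hn1.trans hnB
  have hB0 : (0 : ℝ) ≤ max (n : ℝ) ‖v‖ := zero_le_one.trans hB1
  generalize hB : max (n : ℝ) ‖v‖ = B at *
  have hv : ∀ y, |v y| ≤ B := fun y => hB ▸ (norm_le_pi_norm v y).trans (le_max_right _ _)
  set c := parityCount d n
  have hcd : ∀ a, c a ≤ d := fun a => (Finset.card_le_univ _).trans_eq (Fintype.card_fin d)
  have hc : ∀ a, c a ≤ 2 ^ Nat.clog 2 d := fun a =>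
    (hcd a).trans (Nat.le_pow_clog one_lt_two d)
  -- All `d` coordinates of the origin are even.
  have hpos : ∃ a, 0 < c a := ⟨(0, false), by simpa [c, parityCount, parityCoords] using hd⟩
  have hsum : ∑ a, c a = d * (n + 1) ^ d := sum_parityCount d n
  have hY : Fintype.card (Fin d → Fin (n + 1)) = (n + 1) ^ d := by simp
  have hYB : Fintype.card ((Fin d → Fin (n + 1)) × Bool) = 2 * (n + 1) ^ d := by
    rw [Fintype.card_prod, hY, Fintype.card_bool, mul_comm]
  have hN : (n + 1) ^ d ≤ d * (n + 1) ^ d := Nat.le_mul_of_pos_left _ hd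
  have hw : ∑ a, (c a + 1) ≤ 8 * d * (n + 1) ^ d := by
    rw [Finset.sum_add_distrib, hsum, Finset.sum_const, Finset.card_univ, hYB, smul_eq_mul, mul_one,
      mul_assoc]
    omega
  have hslot : Fintype.card (Slot c) = 2 * (d * (n + 1) ^ d) := by
    rw [card_slot, ← Finset.mul_sum, hsum]
  have : Nonempty (Slot c) := by
    obtain ⟨a, ha⟩ := hpos
    exact ⟨⟨a, ⟨0, ha⟩, false⟩⟩
  -- The pair of neurons of a slot receives `±(n x_i - y_i)`, so its sum is `|n x_i - y_i|`; entries
  -- are at most `n` in absolute value.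
  let W : Slot c → Fin d → ℝ := fun p i =>
    if i = parityEnum p.1 p.2.1 then (if p.2.2 then -(n : ℝ) else n) else 0
  let b : Slot c → ℝ := fun p =>
    if p.2.2 then ((p.1.1 (parityEnum p.1 p.2.1) : ℕ) : ℝ)
      else -((p.1.1 (parityEnum p.1 p.2.1) : ℕ) : ℝ)
  have hW : ∀ p i, |W p i| ≤ B := by
    intro p i
    simp only [W]
    split_ifs <;> simpa
  have hb : ∀ p, |b p| ≤ B := by
    intro p
    have h : ((p.1.1 (parityEnum p.1 p.2.1) : ℕ) : ℝ) ≤ n := by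
      exact_mod_cast Nat.lt_succ_iff.1 (p.1.1 (parityEnum p.1 p.2.1)).2
    simp only [b]
    split_ifs <;> simpa using h.trans hnB
  have hnzW : (Finset.univ.filter fun p : Slot c × Fin d => W p.1 p.2 ≠ 0).card
      ≤ Fintype.card (Slot c) := by
    refine Finset.card_le_card_of_injOn Prod.fst (fun _ _ => Finset.mem_coe.2 (Finset.mem_univ _))
      ?_
    have h : ∀ p i, W p i ≠ 0 → i = parityEnum p.1 p.2.1 := by
      intro p i hp
      by_contra hi
      simp [W, hi] at hp
    rintro ⟨p, i⟩ hp ⟨p', i'⟩ hp' hpp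
    obtain rfl : p = p' := hpp
    rw [h p i (by simpa using hp), h p i' (by simpa using hp')]
  refine ((IsRealizable.hidden hB0 W b hW hb ?_ hnzW (Finset.card_le_univ _)
    (isRealizable_sum_relu_slotMax hB1 v hv (Nat.clog 2 d) c _ hpos hc hw)).mono ?_).congr ?_
  · rw [hslot, mul_assoc]
    omega
  -- With `N = (n + 1) ^ d` and `L = Nat.clog 2 d` the total is `4 d N` for the first layer plus `6
  -- d N + 4 L N + 2 N`; the bound `L + 1 ≤ d` follows from `d ≤ 2 ^ (d - 1)`.
  · have hL : Nat.clog 2 d + 1 ≤ d := by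
      have : Nat.clog 2 d ≤ d - 1 :=
        Nat.clog_le_of_le_pow (by have := Nat.lt_two_pow_self (n := d - 1); omega)
      omega
    have hLN : (4 * Nat.clog 2 d + 2) * (n + 1) ^ d ≤ 6 * d * (n + 1) ^ d :=
      Nat.mul_le_mul_right _ (by omega)
    rw [Finset.sum_add_distrib, ← Finset.mul_sum, hsum, Finset.sum_const, Finset.card_univ, hYB,
      hslot, hY, smul_eq_mul]
    nlinarith
  · intro x _
    refine Finset.sum_congr rfl fun y _ => ?_
    have hrow : ∀ p, ∑ i, W p i * x i + b p
        = if p.2.2 then -((n : ℝ) * x (parityEnum p.1 p.2.1) - (p.1.1 (parityEnum p.1 p.2.1) : ℕ))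
          else (n : ℝ) * x (parityEnum p.1 p.2.1) - (p.1.1 (parityEnum p.1 p.2.1) : ℕ) := by
      intro p
      rw [Finset.sum_eq_single (parityEnum p.1 p.2.1) (fun i _ hi => by simp [W, hi]) (by simp)]
      simp only [W, b]
      split_ifs <;> ring
    have hmax := fun s : Bool => slotMax_abs (fun i => (n : ℝ) * x i) (y, s)
      (x := fun p => relu (∑ i, W p i * x i + b p)) fun j => by
        rw [hrow, hrow]
        exact relu_add_relu_neg _
    rw [hmax false, hmax true]
    rfl

/-! ### Conclusion. -/

theorem mainTheorem1 (d n : ℕ) (hd : 0 < d) (hn : 0 < n) (ω : ℝ → ℝ)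
    (hω : IsModulusOfRegularity (Set.Icc 0 (d : ℝ)) ω) :
    ∃ decoder : ((Fin d → Fin (n + 1)) → ℝ) → ReLUMLP d 1,
      ∀ f : (Fin d → ℝ) → ℝ, IsRegularOn ω (unitCube d) f →
        ∃ Φ : ReLUMLP d 1, Φ = decoder (encoder n f) ∧
          -- size of the network
          Φ.width ≤ 8 * d * (n + 1) ^ d ∧
          (Φ.depth : ℤ) ≤ ⌈Real.logb 2 (d : ℝ)⌉ + 4 ∧
          Φ.numNonzero ≤ 16 * d * (n + 1) ^ d ∧
          Φ.parNorm ≤ max (n : ℝ) ‖encoder n f‖ ∧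
          -- uniform approximation
          (∀ x ∈ unitCube d, |f x - Φ.toFun x| ≤ ω ((d : ℝ) / (2 * n))) ∧
          -- regularity
          IsRegularOn ω (unitCube d) Φ.toFun ∧
          -- interpolation on the grid
          (∀ y : Fin d → Fin (n + 1), Φ.toFun (gridPoint n y) = f (gridPoint n y)) ∧
          -- piecewise linearity with respect to the Kuhn triangulation
          IsKuhnPiecewiseLinear n Φ.toFun ∧
          -- representation by hat functions
          (∀ x : Fin d → ℝ, Φ.toFun x =
            ∑ y : Fin d → Fin (n + 1),
              f (gridPoint n y) * hat (fun i => (y i : ℕ)) (fun i => (n : ℝ) * x i)) ∧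
          -- support
          (∀ x : Fin d → ℝ, Φ.toFun x ≠ 0 →
            ∀ i, -(1 / (n : ℝ)) ≤ x i ∧ x i ≤ 1 + 1 / (n : ℝ)) := by
  choose decoder hdepth hwidth hnonzero hnorm heval using
    fun v : (Fin d → Fin (n + 1)) → ℝ => isRealizable_hatInterpolant hd hn v
  refine ⟨decoder, fun f hf => ⟨decoder (encoder n f), rfl, hwidth _, ?_, hnonzero _, hnorm _, ?_⟩⟩
  -- The depth is exactly `Nat.clog 2 d + 2`: one layer of absolute values, the halving rounds and
  -- the hat layer.
  · have h := Real.ceil_logb_natCast (b := 2) (Nat.cast_nonneg (α := ℝ) d)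
    rw [Int.clog_natCast, Nat.cast_ofNat] at h
    rw [h, hdepth]
    push_cast
    omega
  have hfun : (decoder (encoder n f)).toFun = hatInterpolant n (encoder n f) :=
    funext fun x => heval (encoder n f) x (Set.mem_univ x)
  rw [hfun]
  exact ⟨fun x hx => abs_sub_hatInterpolant_le hn hω hf hx, isRegularOn_hatInterpolant hn hω hf,
    hatInterpolant_gridPoint hn _, isKuhnPiecewiseLinear_hatInterpolant hn _, fun x => rfl,
    fun x hx => mem_of_hatInterpolant_ne_zero hn _ hx⟩
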